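/- Let $H$ be a complex Hilbert space, let $X\subseteq \mathcal B(H)$ be a linear subspace containing the identity operator, and let $C^*(X)\subseteq\mathcal B(H)$ be the $C^*$-algebra generated by $X$. A selfadjoint linear subspace $\mathcal I\subseteq\mathcal B(H)$ is called a boundary subsystem for $X$ in $\mathcal B(H)$ if the quotient map $q_{\mathcal I}\colon \mathcal B(H)\to\mathcal B(H)/\mathcal I$ is completely isometric on $X$, i.e. for all $\nu\ge 1$ and all $[x_{ij}]\in M_\nu(X)$, $$\|[x_{ij}]\|=\inf\{\|[x_{ij}+y_{ij}]\| : y_{ij}\in\mathcal I\},$$ the norms being those of $M_\nu(\mathcal B(H))=\mathcal B(H^\nu)$; it is maximal if it is maximal under inclusion among all boundary subsystems for $X$ in $\mathcal B(H)$. A closed two-sided ideal $I$ of $C^*(X)$ is called a boundary ideal if the quotient map $C^*(X)\to C^*(X)/I$ is completely isometric on $X$, where $M_\nu(C^*(X)/I)\cong M_\nu(C^*(X))/M_\nu(I)$ carries the quotient norm. The Šilov ideal of $X$ in $C^*(X)$ is the largest boundary ideal, that is, the boundary ideal that contains every boundary ideal. If $\mathcal I$ is any maximal boundary subsystem for $X$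 in $\mathcal B(H)$, then the Šilov ideal of $X$ in $C^*(X)$ exists and is equal to $\mathcal I\cap C^*(X)$. -/

import Mathlib

/-- `M_ν(V)`, the matrices with entries in the subspace `V` of `B(H)`, as a subspace of the
C⋆-algebra `M_ν(B(H))`, with the norm of that algebra. -/
def matrixSubspace {H : Type*} [NormedAddCommGroup H] [InnerProductSpace ℂ H] [CompleteSpace H]
    (V : Submodule ℂ (H →L[ℂ] H)) (ν : ℕ) :
    Submodule ℂ (CStarMatrix (Fin ν) (Fin ν) (H →L[ℂ] H)) where
  carrier := {M | ∀ i j, M i j ∈ V}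
  add_mem' := fun ha hb i j => V.add_mem (ha i j) (hb i j)
  zero_mem' := fun _ _ => V.zero_mem
  smul_mem' := fun c _ ha i j => V.smul_mem c (ha i j)

/-- The norm of the class of `x` in `M_ν(S/V) ≃ M_ν(S)/M_ν(V)`, for subspaces `V ⊆ S` of `B(H)`
and `x` in `M_ν(S)`: `‖[x i j + V]‖ = inf {‖[x i j + y i j]‖ : y i j ∈ V}`. This does not depend
on `S`. -/
noncomputable def quotientMatrixNorm {H : Type*} [NormedAddCommGroup H] [InnerProductSpace ℂ H]
    [CompleteSpace H] (V : Submodule ℂ (H →L[ℂ] H)) {ν : ℕ}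
    (x : CStarMatrix (Fin ν) (Fin ν) (H →L[ℂ] H)) : ℝ :=
  ⨅ y : matrixSubspace V ν, ‖x + (y : CStarMatrix (Fin ν) (Fin ν) (H →L[ℂ] H))‖

/-- For subspaces `X, V ⊆ S` of `B(H)`: the quotient map `S → S/V` is completely isometric on `X`. -/
def QuotientCompletelyIsometricOn {H : Type*} [NormedAddCommGroup H] [InnerProductSpace ℂ H]
    [CompleteSpace H] (X V : Submodule ℂ (H →L[ℂ] H)) : Prop :=
  ∀ (ν : ℕ), ∀ x ∈ matrixSubspace X ν, quotientMatrixNorm V x = ‖x‖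

/-- `V` is a boundary subsystem for `X` in `B(H)`: a selfadjoint linear subspace such that the
quotient map `B(H) → B(H)/V` is completely isometric on `X`. -/
structure IsBoundarySubsystem {H : Type*} [NormedAddCommGroup H] [InnerProductSpace ℂ H]
    [CompleteSpace H] (X V : Submodule ℂ (H →L[ℂ] H)) : Prop where
  star_mem : ∀ a ∈ V, star a ∈ V
  completelyIsometric : QuotientCompletelyIsometricOn X V

/-- `C*(X)`, the (unital) C⋆-subalgebra of `B(H)` generated by `X`. -/
noncomputable def generatedCStarAlgebra {H : Type*} [NormedAddCommGroup H] [InnerProductSpace ℂ H]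
    [CompleteSpace H] (X : Submodule ℂ (H →L[ℂ] H)) : StarSubalgebra ℂ (H →L[ℂ] H) :=
  (StarAlgebra.adjoin ℂ (X : Set (H →L[ℂ] H))).topologicalClosure

/-- An ideal of `C*(X)`, viewed as a linear subspace of `B(H)`. -/
noncomputable def idealSubspace {H : Type*} [NormedAddCommGroup H] [InnerProductSpace ℂ H]
    [CompleteSpace H] (X : Submodule ℂ (H →L[ℂ] H)) (I : Ideal (generatedCStarAlgebra X)) :
    Submodule ℂ (H →L[ℂ] H) :=
  (I.restrictScalars ℂ).map (generatedCStarAlgebra X).subtype.toLinearMap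

/-- `I` is a boundary ideal for `X` in `C*(X)`: a closed two-sided ideal such that the quotient map
`C*(X) → C*(X)/I` is completely isometric on `X`. The norm of the C⋆-algebra
`M_ν(C*(X)/I) ≃ M_ν(C*(X))/M_ν(I)` is the quotient norm, an infimum over
`M_ν(I)`. -/
structure IsBoundaryIdeal {H : Type*} [NormedAddCommGroup H] [InnerProductSpace ℂ H]
    [CompleteSpace H] (X : Submodule ℂ (H →L[ℂ] H)) (I : Ideal (generatedCStarAlgebra X)) :
    Prop where
  isTwoSided : I.IsTwoSided
  isClosed : IsClosed (I : Set (generatedCStarAlgebra X))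
  completelyIsometric : QuotientCompletelyIsometricOn X (idealSubspace X I)

/-- `I` is the Šilov ideal of `X` in `C*(X)`: the biggest boundary ideal. -/
def IsSilovIdeal {H : Type*} [NormedAddCommGroup H] [InnerProductSpace ℂ H]
    [CompleteSpace H] (X : Submodule ℂ (H →L[ℂ] H)) (I : Ideal (generatedCStarAlgebra X)) : Prop :=
  IsGreatest {J : Ideal (generatedCStarAlgebra X) | IsBoundaryIdeal X J} I

section OperatorMatrices

open scoped InnerProductSpace

variable {H : Type*} [NormedAddCommGroup H] [InnerProductSpace ℂ H]

/-- The sesquilinear form `∑ i j, ⟪ξ i, M i j (η j)⟫` of a matrix of operators. -/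
noncomputable def matForm {ι : Type*} [Fintype ι] (M : ι → ι → H →L[ℂ] H) (ξ η : ι → H) : ℂ :=
  ∑ i, ∑ j, ⟪ξ i, M i j (η j)⟫_ℂ

/-- A matrix of operators is accretive if the real part of its quadratic form is nonnegative. -/
def IsAccretive {ι : Type*} [Fintype ι] (M : ι → ι → H →L[ℂ] H) : Prop :=
  ∀ ξ : ι → H, 0 ≤ (matForm M ξ ξ).re

/-- The operator on `H ^ ν` defined by a matrix of operators. -/
noncomputable def matOperator {ν : ℕ} (M : CStarMatrix (Fin ν) (Fin ν) (H →L[ℂ] H)) :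
    PiLp 2 (fun _ : Fin ν => H) →L[ℂ] PiLp 2 (fun _ : Fin ν => H) :=
  ((PiLp.continuousLinearEquiv 2 ℂ (fun _ : Fin ν => H)).symm :
      (Fin ν → H) →L[ℂ] PiLp 2 (fun _ : Fin ν => H)) ∘L
    (ContinuousLinearMap.pi fun i => ∑ j, M i j ∘L ContinuousLinearMap.proj j) ∘L
    (PiLp.continuousLinearEquiv 2 ℂ (fun _ : Fin ν => H) :
      PiLp 2 (fun _ : Fin ν => H) →L[ℂ] (Fin ν → H))

theorem matOperator_apply {ν : ℕ} (M : CStarMatrix (Fin ν) (Fin ν) (H →L[ℂ] H))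
    (ξ : PiLp 2 (fun _ : Fin ν => H)) (i : Fin ν) :
    matOperator M ξ i = ∑ j, M i j (ξ j) := by
  simp [matOperator]

theorem inner_matOperator {ν : ℕ} (M : CStarMatrix (Fin ν) (Fin ν) (H →L[ℂ] H))
    (ξ η : PiLp 2 (fun _ : Fin ν => H)) :
    ⟪ξ, matOperator M η⟫_ℂ = matForm M ξ η := by
  simp [PiLp.inner_apply, matOperator_apply, matForm, inner_sum]

variable [CompleteSpace H]

/-- `matOperator` as a homomorphism of C⋆-algebras. -/
noncomputable def matOperatorHom (H : Type*) [NormedAddCommGroup H] [InnerProductSpace ℂ H]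
    [CompleteSpace H] (ν : ℕ) :
    CStarMatrix (Fin ν) (Fin ν) (H →L[ℂ] H) →⋆ₙₐ[ℂ]
      (PiLp 2 (fun _ : Fin ν => H) →L[ℂ] PiLp 2 (fun _ : Fin ν => H)) where
  toFun := matOperator
  map_smul' c M := by
    ext ξ i
    simp [matOperator_apply, Finset.smul_sum]
  map_zero' := by
    ext ξ i
    simp [matOperator_apply]
  map_add' M N := by
    ext ξ i
    simp [matOperator_apply, Finset.sum_add_distrib]
  map_mul' M N := by
    ext ξ i
    simp only [matOperator_apply, mul_apply_eq_comp, CStarMatrix.mul_apply,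
      sum_apply, map_sum]
    exact Finset.sum_comm
  map_star' M := by
    rw [ContinuousLinearMap.star_eq_adjoint, ContinuousLinearMap.eq_adjoint_iff]
    intro ξ η
    simp only [PiLp.inner_apply, matOperator_apply, CStarMatrix.star_apply, inner_sum, sum_inner,
      ContinuousLinearMap.star_eq_adjoint, ContinuousLinearMap.adjoint_inner_left]
    exact Finset.sum_comm

theorem norm_matOperator {ν : ℕ} (M : CStarMatrix (Fin ν) (Fin ν) (H →L[ℂ] H)) :
    ‖matOperator M‖ = ‖M‖ := by
  refine NonUnitalStarAlgHom.norm_map (matOperatorHom H ν) ?_ M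
  intro M N h
  ext i j v
  have h1 := congrArg (fun T => T (PiLp.single 2 j v) i) h
  simpa [matOperatorHom, matOperator_apply, Pi.single_apply, apply_ite] using h1

theorem re_matForm_le {ν : ℕ} (M : CStarMatrix (Fin ν) (Fin ν) (H →L[ℂ] H)) (ξ η : Fin ν → H) :
    2 * |(matForm M ξ η).re| ≤ ‖M‖ * (∑ i, ‖ξ i‖ ^ 2 + ∑ i, ‖η i‖ ^ 2) := by
  set x := WithLp.toLp 2 ξ with hx
  set y := WithLp.toLp 2 η with hy
  have h1 : matForm M ξ η = ⟪x, matOperator M y⟫_ℂ := (inner_matOperator M x y).symm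
  have h2 : ∑ i, ‖ξ i‖ ^ 2 = ‖x‖ ^ 2 := (PiLp.norm_sq_eq_of_L2 _ x).symm
  have h3 : ∑ i, ‖η i‖ ^ 2 = ‖y‖ ^ 2 := (PiLp.norm_sq_eq_of_L2 _ y).symm
  rw [h1, h2, h3]
  have h4 : |(⟪x, matOperator M y⟫_ℂ).re| ≤ ‖x‖ * (‖M‖ * ‖y‖) :=
    (Complex.abs_re_le_norm _).trans ((norm_inner_le_norm _ _).trans (by
      gcongr
      rw [← norm_matOperator]
      exact (matOperator M).le_opNorm y))
  nlinarith [mul_nonneg (norm_nonneg M) (sq_nonneg (‖x‖ - ‖y‖))]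

theorem norm_le_of_matForm {ν : ℕ} (M : CStarMatrix (Fin ν) (Fin ν) (H →L[ℂ] H)) {c : ℝ}
    (hc : 0 < c) (h : ∀ ξ η : Fin ν → H,
      2 * (matForm M ξ η).re ≤ c * (∑ i, ‖ξ i‖ ^ 2 + ∑ i, ‖η i‖ ^ 2)) : ‖M‖ ≤ c := by
  rw [← norm_matOperator]
  refine ContinuousLinearMap.opNorm_le_bound _ hc.le fun y => ?_
  have h1 := h (c⁻¹ • matOperator M y) y
  have h2 : ∑ i, ‖(c⁻¹ • matOperator M y) i‖ ^ 2 = ‖c⁻¹ • matOperator M y‖ ^ 2 :=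
    (PiLp.norm_sq_eq_of_L2 _ _).symm
  have h3 : ∑ i, ‖y i‖ ^ 2 = ‖y‖ ^ 2 := (PiLp.norm_sq_eq_of_L2 _ y).symm
  have h4 : (matForm M (c⁻¹ • matOperator M y) y).re = c⁻¹ * ‖matOperator M y‖ ^ 2 := by
    have : (c⁻¹ • matOperator M y : PiLp 2 (fun _ : Fin ν => H)) =
      ((c⁻¹ : ℝ) : ℂ) • matOperator M y := rfl
    have h5 := inner_matOperator M (c⁻¹ • matOperator M y) y
    rw [this, inner_smul_left, Complex.conj_ofReal] at h5
    rw [← WithLp.ofLp_smul, this, ← h5, Complex.re_ofReal_mul]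
    exact congrArg _ (inner_self_eq_norm_sq (𝕜 := ℂ) _)
  rw [← WithLp.ofLp_smul] at h1
  rw [h2, h3, WithLp.ofLp_smul, h4, norm_smul, Real.norm_of_nonneg (inv_pos.2 hc).le] at h1
  refine abs_le_of_sq_le_sq' ?_ (by positivity) |>.2
  have h6 : c * (c⁻¹ * ‖matOperator M y‖ ^ 2) = ‖matOperator M y‖ ^ 2 := by field_simp
  have h7 : c * (c * (c⁻¹ * ‖matOperator M y‖) ^ 2) = ‖matOperator M y‖ ^ 2 := by field_simp
  nlinarith [mul_le_mul_of_nonneg_left h1 hc.le]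

end OperatorMatrices

section UnitalCompletelyPositive

open scoped InnerProductSpace

variable {H : Type*} [NormedAddCommGroup H] [InnerProductSpace ℂ H]

theorem ContinuousLinearMap.ext_re_inner {a b : H →L[ℂ] H}
    (h : ∀ ξ η : H, (⟪ξ, a η⟫_ℂ).re = (⟪ξ, b η⟫_ℂ).re) : a = b := by
  ext η
  refine ext_inner_left ℂ fun ξ => Complex.ext (h ξ η) ?_
  have := h (Complex.I • ξ) η
  simpa [inner_smul_left] using this

theorem ContinuousLinearMap.eq_of_inner_self {a b : H →L[ℂ] H}
    (h : ∀ ξ : H, ⟪ξ, a ξ⟫_ℂ = ⟪ξ, b ξ⟫_ℂ) : a = b := by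
  have := (ext_inner_map (a : H →ₗ[ℂ] H) (b : H →ₗ[ℂ] H)).1 fun ξ => by
    rw [← inner_conj_symm, ← inner_conj_symm ((b : H →ₗ[ℂ] H) ξ)]
    exact congrArg _ (h ξ)
  exact ContinuousLinearMap.coe_injective this

/-- A unital linear map of `B(H)` which maps accretive matrices to accretive matrices; such maps
are exactly the unital completely positive ones. -/
structure IsUCP (φ : (H →L[ℂ] H) →ₗ[ℂ] (H →L[ℂ] H)) : Prop where
  map_one : φ 1 = 1
  isAccretive_map : ∀ {ι : Type} [Fintype ι] (M : ι → ι → H →L[ℂ] H),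
    IsAccretive M → IsAccretive fun i j => φ (M i j)

namespace IsUCP

variable {φ ψ : (H →L[ℂ] H) →ₗ[ℂ] (H →L[ℂ] H)}

theorem comp (hφ : IsUCP φ) (hψ : IsUCP ψ) : IsUCP (φ ∘ₗ ψ) where
  map_one := by simp [hφ.map_one, hψ.map_one]
  isAccretive_map M hM := hφ.isAccretive_map _ (hψ.isAccretive_map M hM)

theorem re_inner_nonneg (hφ : IsUCP φ) {a : H →L[ℂ] H} (ha : ∀ ξ, 0 ≤ (⟪ξ, a ξ⟫_ℂ).re) (ξ : H) :
    0 ≤ (⟪ξ, φ a ξ⟫_ℂ).re := by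
  have := hφ.isAccretive_map (ι := Unit) (fun _ _ => a)
    (fun ξ => by simpa [matForm] using ha (ξ ())) (fun _ => ξ)
  simpa [matForm] using this

theorem re_inner_mono (hφ : IsUCP φ) {a b : H →L[ℂ] H}
    (hab : ∀ ξ, (⟪ξ, a ξ⟫_ℂ).re ≤ (⟪ξ, b ξ⟫_ℂ).re) (ξ : H) :
    (⟪ξ, φ a ξ⟫_ℂ).re ≤ (⟪ξ, φ b ξ⟫_ℂ).re := by
  have := hφ.re_inner_nonneg (a := b - a) (fun ξ => by simpa [inner_sub_right] using hab ξ) ξ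
  simpa [inner_sub_right] using this

variable [CompleteSpace H]

theorem map_star (hφ : IsUCP φ) (a : H →L[ℂ] H) : φ (star a) = star (φ a) := by
  have key : ∀ (b : H →L[ℂ] H) (ξ η : H),
      0 ≤ (⟪ξ, φ b η⟫_ℂ).re - (⟪η, φ (star b) ξ⟫_ℂ).re := by
    intro b ξ η
    have := hφ.isAccretive_map (ι := Fin 2) ![![0, b], ![-star b, 0]] (fun ζ => by
      have h : (⟪b (ζ 1), ζ 0⟫_ℂ).re = (⟪ζ 0, b (ζ 1)⟫_ℂ).re := by
        rw [← inner_conj_symm, Complex.conj_re]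
      simp [matForm, Fin.sum_univ_two, ContinuousLinearMap.star_eq_adjoint,
        ContinuousLinearMap.adjoint_inner_right, h]) ![ξ, η]
    simp [matForm, Fin.sum_univ_two] at this
    linarith
  refine ContinuousLinearMap.ext_re_inner fun ξ η => ?_
  have h1 := key a η ξ
  have h2 := key (star a) ξ η
  rw [star_star] at h2
  have h3 : (⟪ξ, star (φ a) η⟫_ℂ).re = (⟪η, φ a ξ⟫_ℂ).re := by
    rw [ContinuousLinearMap.star_eq_adjoint, ContinuousLinearMap.adjoint_inner_right,
      ← inner_conj_symm, Complex.conj_re]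
  linarith

/-- The Kadison–Schwarz inequality. -/
theorem norm_sq_apply_le (hφ : IsUCP φ) (a : H →L[ℂ] H) (ξ : H) :
    ‖φ a ξ‖ ^ 2 ≤ (⟪ξ, φ (star a * a) ξ⟫_ℂ).re := by
  have := hφ.isAccretive_map (ι := Fin 2) ![![star a * a, star a], ![a, 1]] (fun ζ => by
    have h : matForm ![![star a * a, star a], ![a, 1]] ζ ζ =
        ⟪a (ζ 0) + ζ 1, a (ζ 0) + ζ 1⟫_ℂ := by
      simp [matForm, Fin.sum_univ_two, ContinuousLinearMap.star_eq_adjoint,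
        ContinuousLinearMap.adjoint_inner_right, -inner_self_eq_norm_sq_to_K]
      ring
    rw [h]
    exact inner_self_nonneg (𝕜 := ℂ)) ![ξ, -φ a ξ]
  have h3 : (⟪ξ, φ (star a) (φ a ξ)⟫_ℂ).re = ‖φ a ξ‖ ^ 2 := by
    rw [hφ.map_star, ContinuousLinearMap.star_eq_adjoint, ContinuousLinearMap.adjoint_inner_right]
    exact inner_self_eq_norm_sq (𝕜 := ℂ) _
  have h4 : (⟪φ a ξ, φ a ξ⟫_ℂ).re = ‖φ a ξ‖ ^ 2 := inner_self_eq_norm_sq (𝕜 := ℂ) _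
  simp [matForm, Fin.sum_univ_two, hφ.map_one] at this
  linarith

theorem norm_le (hφ : IsUCP φ) (a : H →L[ℂ] H) : ‖φ a‖ ≤ ‖a‖ := by
  refine ContinuousLinearMap.opNorm_le_bound _ (norm_nonneg _) fun ξ => ?_
  have h1 := hφ.norm_sq_apply_le a ξ
  have h2 := hφ.re_inner_mono (a := star a * a) (b := ((‖a‖ ^ 2 : ℝ) : ℂ) • 1) (fun η => by
    have h3 : (⟪η, (star a * a) η⟫_ℂ).re = ‖a η‖ ^ 2 := by
      rw [mul_apply_eq_comp, ContinuousLinearMap.star_eq_adjoint,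
        ContinuousLinearMap.adjoint_inner_right]
      exact inner_self_eq_norm_sq (𝕜 := ℂ) _
    have h4 : (⟪η, η⟫_ℂ).re = ‖η‖ ^ 2 := inner_self_eq_norm_sq (𝕜 := ℂ) _
    rw [h3, smul_apply, inner_smul_right, Complex.re_ofReal_mul, one_apply_eq_self, h4, ← mul_pow]
    exact pow_le_pow_left₀ (norm_nonneg _) (a.le_opNorm η) 2) ξ
  have h4 : (⟪ξ, ξ⟫_ℂ).re = ‖ξ‖ ^ 2 := inner_self_eq_norm_sq (𝕜 := ℂ) _
  rw [map_smul, hφ.map_one, smul_apply, inner_smul_right, Complex.re_ofReal_mul,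
    one_apply_eq_self, h4, ← mul_pow] at h2
  exact le_of_sq_le_sq (h1.trans h2) (by positivity)

theorem continuous (hφ : IsUCP φ) : Continuous φ :=
  (φ.mkContinuous 1 fun a => by simpa using hφ.norm_le a).continuous

/-- Unital completely positive maps are completely contractive. -/
theorem norm_map_le (hφ : IsUCP φ) {ν : ℕ} (M : CStarMatrix (Fin ν) (Fin ν) (H →L[ℂ] H)) :
    ‖M.map φ‖ ≤ ‖M‖ := by
  refine le_of_forall_gt_imp_ge_of_dense fun c hc => ?_
  have hc0 : 0 < c := (norm_nonneg _).trans_lt hc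
  refine norm_le_of_matForm _ hc0 fun ξ η => ?_
  set D : Matrix (Fin ν) (Fin ν) (H →L[ℂ] H) :=
    Matrix.diagonal fun _ => ((c / 2 : ℝ) : ℂ) • 1 with hD
  have hsum : ∀ (L : Matrix (Fin ν) (Fin ν) (H →L[ℂ] H)) (ζ : Fin ν ⊕ Fin ν → H),
      (matForm (Matrix.fromBlocks D L 0 D) ζ ζ).re =
      c / 2 * (∑ i, ‖ζ (Sum.inl i)‖ ^ 2 + ∑ i, ‖ζ (Sum.inr i)‖ ^ 2) +
        (matForm L (fun i => ζ (Sum.inl i)) (fun i => ζ (Sum.inr i))).re := by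
    intro L ζ
    have h4 : ∀ x : H, (⟪x, x⟫_ℂ).re = ‖x‖ ^ 2 := fun x => inner_self_eq_norm_sq (𝕜 := ℂ) x
    have h5 : ∀ (i j : Fin ν) (x y : H),
        ⟪x, D i j y⟫_ℂ = if i = j then ((c / 2 : ℝ) : ℂ) * ⟪x, y⟫_ℂ else 0 := by
      intro i j x y
      rw [hD, Matrix.diagonal_apply]
      split_ifs <;> simp
    simp only [matForm, Fintype.sum_sum_type, Matrix.fromBlocks_apply₁₁,
      Matrix.fromBlocks_apply₁₂, Matrix.fromBlocks_apply₂₁, Matrix.fromBlocks_apply₂₂, h5,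
      Finset.sum_ite_eq, Finset.mem_univ, if_true, Matrix.zero_apply, zero_apply,
      inner_zero_right, Finset.sum_const_zero, Finset.sum_add_distrib, Complex.add_re,
      Complex.re_sum, Complex.re_ofReal_mul, h4, ← Finset.mul_sum, Complex.zero_re]
    ring
  have h1 := hφ.isAccretive_map (ι := Fin ν ⊕ Fin ν) (Matrix.fromBlocks D M 0 D) (fun ζ => by
    rw [hsum M ζ]
    have h2 := re_matForm_le M (fun i => ζ (Sum.inl i)) (fun i => ζ (Sum.inr i))
    have h3 : 0 ≤ ∑ i, ‖ζ (Sum.inl i)‖ ^ 2 + ∑ i, ‖ζ (Sum.inr i)‖ ^ 2 := by positivity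
    have h4 := neg_abs_le
      (matForm M (fun i => ζ (Sum.inl i)) (fun i => ζ (Sum.inr i))).re
    nlinarith [mul_le_mul_of_nonneg_right hc.le h3]) (Sum.elim (fun i => -ξ i) η)
  have h7 := hsum (M.map φ) (Sum.elim (fun i => -ξ i) η)
  have h8 : matForm (M.map φ) (fun i => -ξ i) η = -matForm (M.map φ) ξ η := by
    simp [matForm]
  simp only [Sum.elim_inl, Sum.elim_inr, norm_neg, h8] at h7
  have h9 : ∀ L : Matrix (Fin ν) (Fin ν) (H →L[ℂ] H),
      (fun i j => φ (Matrix.fromBlocks D L 0 D i j)) = Matrix.fromBlocks D (L.map φ) 0 D := by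
    intro L
    funext i j
    rcases i with i | i <;> rcases j with j | j <;>
      simp [hD, Matrix.diagonal_apply, apply_ite φ, hφ.map_one]
  have h10 : (matForm (fun i j => φ (Matrix.fromBlocks D M 0 D i j))
      (Sum.elim (fun i => -ξ i) η) (Sum.elim (fun i => -ξ i) η)).re = _ :=
    (congrArg (fun L => (matForm L (Sum.elim (fun i => -ξ i) η)
      (Sum.elim (fun i => -ξ i) η)).re) (h9 M)).trans h7
  rw [h10, Complex.neg_re] at h1
  linarith

end IsUCP

end UnitalCompletelyPositive

section Extension

open scoped InnerProductSpace

variable {H : Type*} [NormedAddCommGroup H] [InnerProductSpace ℂ H]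

theorem exists_inner_eq_of_re_le [CompleteSpace H] (B : H →ₗ⋆[ℂ] H →ₗ[ℂ] ℂ) (C : ℝ)
    (hB : ∀ h k, 2 * (B h k).re ≤ C * (‖h‖ ^ 2 + ‖k‖ ^ 2)) :
    ∃ T : H →L[ℂ] H, ∀ h k, ⟪h, T k⟫_ℂ = B h k := by
  have h1 : ∀ h k, 2 * ‖B h k‖ ≤ C * (‖h‖ ^ 2 + ‖k‖ ^ 2) := by
    intro h k
    obtain ⟨u, hu, hu'⟩ : ∃ u : ℂ, ‖u‖ = 1 ∧ u * B h k = ‖B h k‖ := by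
      by_cases h0 : B h k = 0
      · exact ⟨1, by simp, by simp [h0]⟩
      · have h2 : (‖B h k‖ : ℂ) ≠ 0 := by simpa using h0
        refine ⟨‖B h k‖ / B h k, by simp [h0], by field_simp⟩
    have h2 := hB h (u • k)
    rwa [map_smul, smul_eq_mul, hu', Complex.ofReal_re, norm_smul, hu, one_mul] at h2
  have h2 : ∀ h k, ‖B h k‖ ≤ C * ‖h‖ * ‖k‖ := by
    intro h k
    rcases (norm_nonneg h).eq_or_lt with hh | hh
    · have : h = 0 := norm_eq_zero.1 hh.symm
      simp [this]
    rcases (norm_nonneg k).eq_or_lt with hk | hk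
    · have : k = 0 := norm_eq_zero.1 hk.symm
      simp [this]
    have h3 := h1 ((‖k‖ : ℂ) • h) ((‖h‖ : ℂ) • k)
    simp only [map_smulₛₗ, LinearMap.smul_apply, norm_smul, Complex.norm_real, norm_norm,
      Complex.conj_ofReal, RingHom.id_apply] at h3
    have h4 : 0 < ‖h‖ * ‖k‖ := mul_pos hh hk
    refine le_of_mul_le_mul_left (a := ‖h‖ * ‖k‖) ?_ h4
    nlinarith
  refine ⟨ContinuousLinearMap.adjoint
    (InnerProductSpace.continuousLinearMapOfBilin (B.mkContinuous₂ C h2)), fun h k => ?_⟩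
  rw [ContinuousLinearMap.adjoint_inner_right, InnerProductSpace.continuousLinearMapOfBilin_apply,
    LinearMap.mkContinuous₂_apply]

theorem CStarMatrix.smul_one_apply {ν : ℕ} (c : ℂ) (i j : Fin ν) :
    (c • (1 : CStarMatrix (Fin ν) (Fin ν) (H →L[ℂ] H))) i j = if i = j then c • 1 else 0 := by
  rw [CStarMatrix.smul_apply, CStarMatrix.one_apply, smul_ite, smul_zero]

theorem isAccretive_of_norm_sub_le [CompleteSpace H] {ν : ℕ}
    {M N : CStarMatrix (Fin ν) (Fin ν) (H →L[ℂ] H)}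
    (h : ∀ t : ℝ, ‖N - (t : ℂ) • 1‖ ≤ ‖M - (t : ℂ) • 1‖) (hM : IsAccretive M) :
    IsAccretive N := by
  have hsub : ∀ (L : CStarMatrix (Fin ν) (Fin ν) (H →L[ℂ] H)) (t : ℝ)
      (x : PiLp 2 fun _ : Fin ν => H),
      matOperator (L - (t : ℂ) • 1) x = matOperator L x - (t : ℂ) • x := by
    intro L t x
    ext i
    have h1 : ∀ j, (if i = j then (t : ℂ) • 1 else 0 : H →L[ℂ] H) (x j) =
        if i = j then (t : ℂ) • x j else 0 := fun j => by split_ifs <;> simp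
    simp only [matOperator_apply, CStarMatrix.sub_apply, CStarMatrix.smul_one_apply, sub_apply, h1,
      Finset.sum_sub_distrib, Finset.sum_ite_eq, Finset.mem_univ, if_true, PiLp.sub_apply,
      PiLp.smul_apply]
  have hbound : ∀ t : ℝ, 0 < t → ‖M - (t : ℂ) • 1‖ ≤ t + ‖M‖ ^ 2 / (2 * t) := by
    intro t ht
    rw [← norm_matOperator]
    refine ContinuousLinearMap.opNorm_le_bound _ (by positivity) fun x => ?_
    have h1 : ‖matOperator M x‖ ≤ ‖M‖ * ‖x‖ := by
      rw [← norm_matOperator]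
      exact (matOperator M).le_opNorm x
    have h2 : 0 ≤ (⟪x, matOperator M x⟫_ℂ).re := by
      rw [inner_matOperator]
      exact hM x
    have h3 : ‖matOperator M x - (t : ℂ) • x‖ ^ 2 = ‖matOperator M x‖ ^ 2 -
        2 * (t * (⟪x, matOperator M x⟫_ℂ).re) + (t * ‖x‖) ^ 2 := by
      rw [norm_sub_rev, norm_sub_sq (𝕜 := ℂ), inner_smul_left, Complex.conj_ofReal,
        norm_smul, Complex.norm_real, Real.norm_of_nonneg ht.le]
      simp only [RCLike.re_to_complex, Complex.re_ofReal_mul]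
      ring
    rw [hsub]
    refine le_of_sq_le_sq ?_ (by positivity)
    have h4 : (t + ‖M‖ ^ 2 / (2 * t)) ^ 2 = t ^ 2 + ‖M‖ ^ 2 + (‖M‖ ^ 2 / (2 * t)) ^ 2 := by
      field_simp
      ring
    rw [h3, mul_pow (t + _), h4, mul_pow]
    have h5 := pow_le_pow_left₀ (norm_nonneg _) h1 2
    have h6 : 0 ≤ (‖M‖ ^ 2 / (2 * t)) ^ 2 * ‖x‖ ^ 2 := by positivity
    nlinarith [mul_nonneg ht.le h2]
  intro ξ
  set x := WithLp.toLp 2 ξ with hx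
  have h0 : matForm N ξ ξ = ⟪x, matOperator N x⟫_ℂ := (inner_matOperator N x x).symm
  rw [h0]
  have key : ∀ t : ℝ, 0 < t → -(‖M‖ ^ 2 / 2 * ‖x‖ ^ 2) ≤ t * (⟪x, matOperator N x⟫_ℂ).re := by
    intro t ht
    have h1 : |(⟪x, matOperator (N - (t : ℂ) • 1) x⟫_ℂ).re| ≤
        ‖x‖ * ((t + ‖M‖ ^ 2 / (2 * t)) * ‖x‖) :=
      (Complex.abs_re_le_norm _).trans ((norm_inner_le_norm _ _).trans (by
        gcongr
        refine (ContinuousLinearMap.le_opNorm _ x).trans ?_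
        rw [norm_matOperator]
        gcongr
        exact (h t).trans (hbound t ht)))
    have h2 := (abs_le.1 h1).1
    have h3 : (⟪x, x⟫_ℂ).re = ‖x‖ ^ 2 := inner_self_eq_norm_sq (𝕜 := ℂ) x
    rw [hsub, inner_sub_right, inner_smul_right, Complex.sub_re, Complex.re_ofReal_mul, h3] at h2
    have h4 : -(‖M‖ ^ 2 / (2 * t) * ‖x‖ ^ 2) ≤ (⟪x, matOperator N x⟫_ℂ).re := by linarith
    have h5 := mul_le_mul_of_nonneg_left h4 ht.le
    have h6 : t * -(‖M‖ ^ 2 / (2 * t) * ‖x‖ ^ 2) = -(‖M‖ ^ 2 / 2 * ‖x‖ ^ 2) := by field_simp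
    rwa [h6] at h5
  by_contra! hneg
  set r := (⟪x, matOperator N x⟫_ℂ).re
  have h1 := key ((‖M‖ ^ 2 / 2 * ‖x‖ ^ 2 + 1) / -r) (div_pos (by positivity) (by linarith))
  have h2 : (‖M‖ ^ 2 / 2 * ‖x‖ ^ 2 + 1) / -r * r = -(‖M‖ ^ 2 / 2 * ‖x‖ ^ 2 + 1) := by
    have : r ≠ 0 := hneg.ne
    field_simp
  linarith

/-- For a linear map `g` of `B(H)` and a linear map `T` of `H`, the functional
`∑ a ⊗ (h, k) ↦ ∑ ⟪T h, g a (T k)⟫` on formal sums of operators with coefficients in `H × H`. -/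
noncomputable def formalPairing (g : (H →L[ℂ] H) →ₗ[ℂ] (H →L[ℂ] H)) (T : H →ₗ[ℂ] H) :
    ((H × H) →₀ (H →L[ℂ] H)) →ₗ[ℂ] ℂ :=
  Finsupp.lsum ℂ fun p =>
    (innerSL ℂ (T p.1)).toLinearMap ∘ₗ (ContinuousLinearMap.apply ℂ H (T p.2)).toLinearMap ∘ₗ g

theorem formalPairing_apply (g : (H →L[ℂ] H) →ₗ[ℂ] (H →L[ℂ] H)) (T : H →ₗ[ℂ] H)
    (a : (H × H) →₀ (H →L[ℂ] H)) :
    formalPairing g T a = ∑ p ∈ a.support, ⟪T p.1, g (a p) (T p.2)⟫_ℂ := by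
  simp [formalPairing, Finsupp.sum]

theorem formalPairing_single (g : (H →L[ℂ] H) →ₗ[ℂ] (H →L[ℂ] H)) (T : H →ₗ[ℂ] H)
    (p : H × H) (a : H →L[ℂ] H) :
    formalPairing g T (Finsupp.single p a) = ⟪T p.1, g a (T p.2)⟫_ℂ := by
  simp [formalPairing]

/-- The formal sums which pair to an accretive form with every linear map of `H`. -/
noncomputable def accretiveCone (H : Type*) [NormedAddCommGroup H] [InnerProductSpace ℂ H] :
    PointedCone ℝ ((H × H) →₀ (H →L[ℂ] H)) where
  carrier := {a | ∀ T, 0 ≤ (formalPairing LinearMap.id T a).re}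
  add_mem' ha hb T := by
    rw [map_add, Complex.add_re]
    exact add_nonneg (ha T) (hb T)
  zero_mem' T := by simp
  smul_mem' c a ha T := by
    have h : c • a = ((c : ℝ) : ℂ) • a := rfl
    rw [h, map_smul, smul_eq_mul, Complex.re_ofReal_mul]
    exact mul_nonneg c.2 (ha T)

/-- The formal sums with all operators in a given subspace. -/
def formalSubspace (Y : Submodule ℂ (H →L[ℂ] H)) : Submodule ℝ ((H × H) →₀ (H →L[ℂ] H)) where
  carrier := {a | ∀ p, a p ∈ Y}
  add_mem' ha hb p := Y.add_mem (ha p) (hb p)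
  zero_mem' _ := Y.zero_mem
  smul_mem' c _ ha p := Y.smul_mem (c : ℂ) (ha p)

theorem single_mem_formalSubspace {Y : Submodule ℂ (H →L[ℂ] H)} {a : H →L[ℂ] H} (ha : a ∈ Y)
    (p : H × H) : Finsupp.single p a ∈ formalSubspace Y := by
  classical
  intro q
  rw [Finsupp.single_apply]
  split_ifs
  exacts [ha, Y.zero_mem]

theorem exists_add_mem_accretiveCone {Y : Submodule ℂ (H →L[ℂ] H)} (hY : 1 ∈ Y)
    (a : (H × H) →₀ (H →L[ℂ] H)) :
    ∃ x ∈ formalSubspace Y, x + a ∈ accretiveCone H := by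
  induction a using Finsupp.induction_linear with
  | zero => exact ⟨0, zero_mem _, by simp⟩
  | add a b ha hb =>
    obtain ⟨x, hx, hxa⟩ := ha
    obtain ⟨y, hy, hyb⟩ := hb
    refine ⟨x + y, add_mem hx hy, ?_⟩
    rw [add_add_add_comm]
    exact add_mem hxa hyb
  | single p a =>
    refine ⟨Finsupp.single (p.1, p.1) ((‖a‖ : ℂ) • 1) + Finsupp.single (p.2, p.2) ((‖a‖ : ℂ) • 1),
      add_mem (single_mem_formalSubspace (Y.smul_mem _ hY) _)
        (single_mem_formalSubspace (Y.smul_mem _ hY) _), fun T => ?_⟩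
    have h3 : ∀ x : H, (⟪x, x⟫_ℂ).re = ‖x‖ ^ 2 := fun x => inner_self_eq_norm_sq (𝕜 := ℂ) x
    have h4 : |(⟪T p.1, a (T p.2)⟫_ℂ).re| ≤ ‖T p.1‖ * (‖a‖ * ‖T p.2‖) :=
      (Complex.abs_re_le_norm _).trans ((norm_inner_le_norm _ _).trans (by
        gcongr
        exact a.le_opNorm _))
    have h5 := (abs_le.1 h4).1
    simp only [map_add, formalPairing_single, LinearMap.id_apply, smul_apply, one_apply_eq_self,
      inner_smul_right, Complex.add_re, Complex.re_ofReal_mul, h3]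
    nlinarith [mul_nonneg (norm_nonneg a) (sq_nonneg (‖T p.1‖ - ‖T p.2‖)),
      mul_nonneg (norm_nonneg a) (sq_nonneg (‖T p.1‖)),
      mul_nonneg (norm_nonneg a) (sq_nonneg (‖T p.2‖))]

theorem formalPairing_eq_matForm (g : (H →L[ℂ] H) →ₗ[ℂ] (H →L[ℂ] H)) {n : ℕ}
    (c : Fin n → H →ₗ[ℂ] ℂ) (η : Fin n → H) (T : H →ₗ[ℂ] H) (a : (H × H) →₀ (H →L[ℂ] H))
    (hT : ∀ p ∈ a.support, T p.1 = ∑ i, c i p.1 • η i ∧ T p.2 = ∑ i, c i p.2 • η i) :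
    formalPairing g T a = matForm (fun i j => g (∑ p ∈ a.support,
      (starRingEnd ℂ (c i p.1) * c j p.2) • a p)) η η := by
  rw [formalPairing_apply]
  simp only [matForm, map_sum, map_smul, sum_apply, smul_apply, inner_sum, inner_smul_right]
  rw [Finset.sum_congr rfl fun i _ => Finset.sum_comm, Finset.sum_comm]
  refine Finset.sum_congr rfl fun p hp => ?_
  rw [(hT p hp).1, (hT p hp).2]
  simp only [sum_inner, map_sum, map_smul, inner_sum, inner_smul_left, inner_smul_right, Finset.mul_sum]
  rw [Finset.sum_comm]
  exact Finset.sum_congr rfl fun i _ => Finset.sum_congr rfl fun j _ => by ring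

theorem formalPairing_re_nonneg [CompleteSpace H] {Y : Submodule ℂ (H →L[ℂ] H)} (hY : 1 ∈ Y)
    {f : (H →L[ℂ] H) →ₗ[ℂ] (H →L[ℂ] H)} (hf1 : f 1 = 1)
    (hf : ∀ ν, ∀ M ∈ matrixSubspace Y ν, ‖M.map f‖ ≤ ‖M‖)
    {a : (H × H) →₀ (H →L[ℂ] H)} (haY : a ∈ formalSubspace Y) (ha : a ∈ accretiveCone H) :
    0 ≤ (formalPairing f LinearMap.id a).re := by
  classical
  set F : Submodule ℂ H :=
    Submodule.span ℂ (a.support.image Prod.fst ∪ a.support.image Prod.snd : Finset H) with hF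
  have hF1 : ∀ p ∈ a.support, p.1 ∈ F := fun p hp => Submodule.subset_span (by
    simp only [Finset.coe_union, Finset.coe_image, Set.mem_union]
    exact Or.inl ⟨p, hp, rfl⟩)
  have hF2 : ∀ p ∈ a.support, p.2 ∈ F := fun p hp => Submodule.subset_span (by
    simp only [Finset.coe_union, Finset.coe_image, Set.mem_union]
    exact Or.inr ⟨p, hp, rfl⟩)
  have : FiniteDimensional ℂ F := FiniteDimensional.span_finset ℂ _
  set b := stdOrthonormalBasis ℂ F
  set c : Fin (Module.finrank ℂ F) → H →ₗ[ℂ] ℂ := fun i => (innerSL ℂ (b i : H)).toLinearMap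
  have hc : ∀ x ∈ F, ∑ i, c i x • (b i : H) = x := fun x hx => by
    have := congrArg (Subtype.val) (b.sum_repr' ⟨x, hx⟩)
    simpa [c] using this
  set M : CStarMatrix (Fin (Module.finrank ℂ F)) (Fin (Module.finrank ℂ F)) (H →L[ℂ] H) :=
    CStarMatrix.ofMatrix (Matrix.of fun i j => ∑ p ∈ a.support,
      (starRingEnd ℂ (c i p.1) * c j p.2) • a p) with hM
  have hMY : M ∈ matrixSubspace Y _ := fun i j =>
    Y.sum_mem fun p _ => Y.smul_mem _ (haY p)
  have h1 : IsAccretive M := by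
    intro η
    have h2 := ha (∑ i, (c i).smulRight (η i))
    rwa [formalPairing_eq_matForm LinearMap.id c η _ a (fun p _ => by simp)] at h2
  have h2 : IsAccretive (M.map f) := by
    refine isAccretive_of_norm_sub_le (fun t => ?_) h1
    have h3 : M.map f - (t : ℂ) • 1 = (M - (t : ℂ) • 1).map f := by
      refine CStarMatrix.ext fun i j => ?_
      simp only [CStarMatrix.map_apply, CStarMatrix.sub_apply, CStarMatrix.smul_one_apply, map_sub,
        apply_ite f, map_smul, hf1, map_zero]
    rw [h3]
    refine hf _ _ fun i j => Y.sub_mem (hMY i j) (Y.smul_mem _ ?_)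
    rw [CStarMatrix.one_apply]
    split_ifs
    exacts [hY, Y.zero_mem]
  rw [formalPairing_eq_matForm f c (fun i => (b i : H)) _ a
    (fun p hp => ⟨(hc _ (hF1 p hp)).symm, (hc _ (hF2 p hp)).symm⟩)]
  exact h2 _

/-- Arveson's extension theorem, for a unital complete contraction on a subspace of `B(H)` which
contains the identity. -/
theorem exists_isUCP_extension [CompleteSpace H] {Y : Submodule ℂ (H →L[ℂ] H)} (hY : 1 ∈ Y)
    {f : (H →L[ℂ] H) →ₗ[ℂ] (H →L[ℂ] H)} (hf1 : f 1 = 1)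
    (hf : ∀ ν, ∀ M ∈ matrixSubspace Y ν, ‖M.map f‖ ≤ ‖M‖) :
    ∃ φ : (H →L[ℂ] H) →ₗ[ℂ] (H →L[ℂ] H), IsUCP φ ∧ ∀ y ∈ Y, φ y = f y := by
  obtain ⟨g, hg, hgC⟩ := riesz_extension (accretiveCone H)
    ⟨formalSubspace Y, (Complex.reLm ∘ₗ
      (formalPairing f LinearMap.id).restrictScalars ℝ) ∘ₗ (formalSubspace Y).subtype⟩
    (fun x hx => formalPairing_re_nonneg hY hf1 hf x.2 hx)
    (fun a => by
      obtain ⟨x, hx, hxa⟩ := exists_add_mem_accretiveCone hY a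
      exact ⟨⟨x, hx⟩, hxa⟩)
  replace hg : ∀ x ∈ formalSubspace Y, g x = (formalPairing f LinearMap.id x).re :=
    fun x hx => hg ⟨x, hx⟩
  set G : Module.Dual ℂ ((H × H) →₀ (H →L[ℂ] H)) := Module.Dual.extendRCLike g with hG
  have hGre : ∀ x, (G x).re = g x := fun x => Module.Dual.re_extendRCLike_apply (𝕜 := ℂ) g x
  have hGnull : ∀ x, (∀ T, formalPairing LinearMap.id T x = 0) → G x = 0 := by
    have hnull : ∀ x, (∀ T, formalPairing LinearMap.id T x = 0) → (G x).re = 0 := by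
      intro x hx
      have h1 := hgC x (fun T => by simp [hx])
      have h2 := hgC (-x) (fun T => by simp [hx])
      rw [map_neg] at h2
      rw [hGre]
      linarith
    intro x hx
    refine Complex.ext (hnull x hx) ?_
    have := hnull (Complex.I • x) (fun T => by simp [hx])
    simpa using this
  have hGeq : ∀ x y, (∀ T, formalPairing LinearMap.id T x = formalPairing LinearMap.id T y) →
      G x = G y := by
    intro x y hxy
    rw [← sub_eq_zero, ← map_sub]
    exact hGnull _ fun T => by rw [map_sub, hxy, sub_self]
  have hex : ∀ a : H →L[ℂ] H, ∃ T : H →L[ℂ] H,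
      ∀ h k, ⟪h, T k⟫_ℂ = G (Finsupp.single (h, k) a) := by
    intro a
    refine exists_inner_eq_of_re_le (LinearMap.mk₂'ₛₗ (starRingEnd ℂ) (RingHom.id ℂ)
      (fun h k => G (Finsupp.single (h, k) a)) ?_ ?_ ?_ ?_) ‖a‖ ?_
    · intro h h' k
      rw [← map_add]
      exact hGeq _ _ fun T => by simp [formalPairing_single]
    · intro c h k
      rw [← map_smul]
      exact hGeq _ _ fun T => by
        rw [map_smul]
        simp [formalPairing_single, mul_comm]
    · intro h k k'
      rw [← map_add]
      exact hGeq _ _ fun T => by simp [formalPairing_single]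
    · intro c h k
      rw [RingHom.id_apply, ← map_smul]
      exact hGeq _ _ fun T => by
        rw [map_smul]
        simp [formalPairing_single]
    · intro h k
      have h3 : ∀ x : H, (⟪x, x⟫_ℂ).re = ‖x‖ ^ 2 := fun x => inner_self_eq_norm_sq (𝕜 := ℂ) x
      have h1 := hgC (Finsupp.single (h, h) ((‖a‖ : ℂ) • 1) +
          Finsupp.single (k, k) ((‖a‖ : ℂ) • 1) - (2 : ℂ) • Finsupp.single (h, k) a) (fun T => by
        have h4 : |(⟪T h, a (T k)⟫_ℂ).re| ≤ ‖T h‖ * (‖a‖ * ‖T k‖) :=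
          (Complex.abs_re_le_norm _).trans ((norm_inner_le_norm _ _).trans (by
            gcongr
            exact a.le_opNorm _))
        have h5 := (abs_le.1 h4).2
        simp only [map_add, map_sub, map_smul, formalPairing_single, LinearMap.id_apply,
          smul_apply, one_apply_eq_self, inner_smul_right, Complex.add_re, Complex.sub_re,
          Complex.re_ofReal_mul, h3, smul_eq_mul]
        rw [← Complex.ofReal_ofNat, Complex.re_ofReal_mul]
        nlinarith [mul_nonneg (norm_nonneg a) (sq_nonneg (‖T h‖ - ‖T k‖))])
      have h6 : ∀ x : H, (G (Finsupp.single (x, x) ((‖a‖ : ℂ) • 1))).re = ‖a‖ * ‖x‖ ^ 2 := by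
        intro x
        rw [hGre, hg _ (single_mem_formalSubspace (Y.smul_mem _ hY) _), formalPairing_single]
        simp only [map_smul, hf1, smul_apply, one_apply_eq_self, inner_smul_right,
          Complex.re_ofReal_mul, LinearMap.id_apply, h3]
      rw [← hGre, map_sub, map_add, map_smul, Complex.sub_re, Complex.add_re, h6, h6, smul_eq_mul,
        ← Complex.ofReal_ofNat, Complex.re_ofReal_mul] at h1
      rw [LinearMap.mk₂'ₛₗ_apply]
      linarith
  choose φ hφ using hex
  have hφre : ∀ a h k, (⟪h, φ a k⟫_ℂ).re = g (Finsupp.single (h, k) a) := fun a h k => by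
    rw [hφ, hGre]
  let Φ : (H →L[ℂ] H) →ₗ[ℂ] (H →L[ℂ] H) :=
    { toFun := φ
      map_add' := fun a b => by
        ext k
        refine ext_inner_left ℂ fun h => ?_
        rw [add_apply, inner_add_right, hφ, hφ, hφ, Finsupp.single_add, map_add]
      map_smul' := fun c a => by
        ext k
        refine ext_inner_left ℂ fun h => ?_
        rw [RingHom.id_apply, smul_apply, inner_smul_right, hφ, hφ, ← Finsupp.smul_single,
          map_smul, smul_eq_mul] }
  have hΦ : ∀ y ∈ Y, Φ y = f y := fun y hy => ContinuousLinearMap.ext_re_inner fun h k => by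
    change (⟪h, φ y k⟫_ℂ).re = _
    rw [hφre, hg _ (single_mem_formalSubspace hy _), formalPairing_single]
    rfl
  refine ⟨Φ, ⟨(hΦ 1 hY).trans hf1, fun M hM ξ => ?_⟩, hΦ⟩
  have h1 : (matForm (fun i j => Φ (M i j)) ξ ξ).re =
      g (∑ i, ∑ j, Finsupp.single (ξ i, ξ j) (M i j)) := by
    simp only [matForm, Complex.re_sum, map_sum, ← hφre]
    rfl
  rw [h1]
  refine hgC _ fun T => ?_
  simp only [map_sum, formalPairing_single, LinearMap.id_apply]
  exact hM fun i => T (ξ i)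

end Extension

section ChoiEffros

open scoped InnerProductSpace

variable {H : Type*} [NormedAddCommGroup H] [InnerProductSpace ℂ H] [CompleteSpace H]
  {φ ρ : (H →L[ℂ] H) →ₗ[ℂ] (H →L[ℂ] H)}

theorem re_inner_star_mul_self (a : H →L[ℂ] H) (ξ : H) :
    (⟪ξ, (star a * a) ξ⟫_ℂ).re = ‖a ξ‖ ^ 2 := by
  rw [mul_apply_eq_comp, ContinuousLinearMap.star_eq_adjoint,
    ContinuousLinearMap.adjoint_inner_right]
  exact inner_self_eq_norm_sq (𝕜 := ℂ) _

theorem Complex.eq_zero_of_forall_re_mul_nonneg {w : ℂ} {K : ℝ}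
    (h : ∀ z : ℂ, 0 ≤ 2 * (z * w).re + ‖z‖ ^ 2 * K) : w = 0 := by
  by_contra hw
  have h1 : 0 < ‖w‖ ^ 2 := by positivity
  have hK : 0 < |K| + 1 := by positivity
  have h2 := h (-(((|K| + 1)⁻¹ : ℝ) : ℂ) * starRingEnd ℂ w)
  have h3 : (-(((|K| + 1)⁻¹ : ℝ) : ℂ) * starRingEnd ℂ w * w).re = -((|K| + 1)⁻¹ * ‖w‖ ^ 2) := by
    rw [mul_assoc, mul_comm (starRingEnd ℂ w), Complex.mul_conj, Complex.normSq_eq_norm_sq,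
      neg_mul, Complex.neg_re, Complex.re_ofReal_mul, Complex.ofReal_re]
  rw [h3, norm_mul, norm_neg, Complex.norm_real, RCLike.norm_conj,
    Real.norm_of_nonneg (inv_pos.2 hK).le] at h2
  have h4 : (|K| + 1)⁻¹ * K ≤ 1 := by
    rw [inv_mul_le_iff₀ hK]
    linarith [le_abs_self K]
  have h5 : 0 < (|K| + 1)⁻¹ * ‖w‖ ^ 2 := mul_pos (inv_pos.2 hK) h1
  nlinarith [mul_le_mul_of_nonneg_left h4 h5.le]

namespace IsUCP

theorem map_star_mul_eq_zero (hφ : IsUCP φ) (hidem : ∀ a, φ (φ a) = φ a) {b c : H →L[ℂ] H}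
    (hc : φ c = c) (hb : φ b = 0) : φ (star c * b) = 0 := by
  refine ContinuousLinearMap.eq_of_inner_self fun ξ => ?_
  rw [zero_apply, inner_zero_right]
  refine Complex.eq_zero_of_forall_re_mul_nonneg (K := (⟪ξ, φ (star b * b) ξ⟫_ℂ).re) fun z => ?_
  have h1 := hφ.re_inner_mono (a := star c * c) (b := φ (star (c + z • b) * (c + z • b)))
    (fun η => by
      have := hφ.norm_sq_apply_le (c + z • b) η
      rwa [map_add, map_smul, hb, smul_zero, add_zero, hc, ← re_inner_star_mul_self] at this) ξ
  rw [hidem] at h1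
  have h2 : star (c + z • b) * (c + z • b) = star c * c + z • (star c * b) +
      starRingEnd ℂ z • star (star c * b) + ((‖z‖ ^ 2 : ℝ) : ℂ) • (star b * b) := by
    have : ((‖z‖ ^ 2 : ℝ) : ℂ) = z * starRingEnd ℂ z := by
      rw [Complex.mul_conj, Complex.normSq_eq_norm_sq]
    rw [this, star_add, star_smul, star_mul, star_star]
    simp only [add_mul, mul_add, smul_mul_assoc, mul_smul_comm, Complex.star_def]
    module
  have h3 : (⟪ξ, (starRingEnd ℂ z • star (φ (star c * b))) ξ⟫_ℂ).re =
      (z * ⟪ξ, φ (star c * b) ξ⟫_ℂ).re := by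
    rw [smul_apply, inner_smul_right, ContinuousLinearMap.star_eq_adjoint,
      ContinuousLinearMap.adjoint_inner_right, ← inner_conj_symm, ← map_mul, Complex.conj_re]
  rw [h2, map_add, map_add, map_add, map_smul, map_smul, map_smul, hφ.map_star, add_apply,
    add_apply, add_apply, inner_add_right, inner_add_right, inner_add_right, Complex.add_re,
    Complex.add_re, Complex.add_re, h3, smul_apply, smul_apply, inner_smul_right, inner_smul_right,
    Complex.re_ofReal_mul] at h1
  linarith

theorem map_mul_eq_zero (hφ : IsUCP φ) (hidem : ∀ a, φ (φ a) = φ a) {b c : H →L[ℂ] H}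
    (hc : φ c = c) (hb : φ b = 0) : φ (c * b) = 0 := by
  have := hφ.map_star_mul_eq_zero hidem (c := star c) (by rw [hφ.map_star, hc]) hb
  rwa [star_star] at this

/-- The Choi–Effros identity. -/
theorem map_mul_map (hφ : IsUCP φ) (hidem : ∀ a, φ (φ a) = φ a) {c : H →L[ℂ] H}
    (hc : φ c = c) (b : H →L[ℂ] H) : φ (c * φ b) = φ (c * b) := by
  have := hφ.map_mul_eq_zero hidem hc (b := φ b - b) (by rw [map_sub, hidem, sub_self])
  rwa [mul_sub, map_sub, sub_eq_zero] at this

theorem re_inner_map_star_mul_le (hφ : IsUCP φ) (hρ : IsUCP ρ) (hφρ : ∀ a, φ (ρ a) = ρ a)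
    {c : H →L[ℂ] H} (hc : ρ c = c) (ξ : H) :
    (⟪ξ, φ (star c * c) ξ⟫_ℂ).re ≤ (⟪ξ, ρ (star c * c) ξ⟫_ℂ).re := by
  have h := hφ.re_inner_mono (a := star c * c) (b := ρ (star c * c)) (fun η => by
    have := hρ.norm_sq_apply_le c η
    rwa [hc, ← re_inner_star_mul_self] at this) ξ
  rwa [hφρ] at h

/-- Two completely positive projections with the same range induce the same Choi–Effros product. -/
theorem map_mul_eq_map_mul (hφ : IsUCP φ) (hρ : IsUCP ρ) (hφρ : ∀ a, φ (ρ a) = ρ a)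
    (hρφ : ∀ a, ρ (φ a) = φ a) {c d : H →L[ℂ] H} (hc : φ c = c) (hd : φ d = d) :
    φ (c * d) = ρ (c * d) := by
  have hρc : ∀ {a}, φ a = a → ρ a = a := fun {a} ha => by rw [← ha, hρφ]
  have sq : ∀ a, φ a = a → φ (star a * a) = ρ (star a * a) := by
    intro a ha
    have him : ∀ {ψ : (H →L[ℂ] H) →ₗ[ℂ] (H →L[ℂ] H)}, IsUCP ψ → ∀ ξ,
        (⟪ξ, ψ (star a * a) ξ⟫_ℂ).im = 0 := by
      intro ψ hψ ξ
      rw [← Complex.conj_eq_iff_im, inner_conj_symm, ← ContinuousLinearMap.adjoint_inner_right,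
        ← ContinuousLinearMap.star_eq_adjoint, ← hψ.map_star, star_mul, star_star]
    refine ContinuousLinearMap.eq_of_inner_self fun ξ => Complex.ext ?_ ?_
    · exact le_antisymm (hφ.re_inner_map_star_mul_le hρ hφρ (hρc ha) ξ)
        (hρ.re_inner_map_star_mul_le hφ hρφ ha ξ)
    · rw [him hφ, him hρ]
  have polar : ∀ a b, φ a = a → φ b = b →
      φ (star a * b) + φ (star b * a) = ρ (star a * b) + ρ (star b * a) := by
    intro a b ha hb
    have h := sq (a + b) (by rw [map_add, ha, hb])
    simp only [star_add, add_mul, mul_add, map_add, sq a ha, sq b hb] at h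
    have h' := congrArg (fun t => t - ρ (star a * a) - ρ (star b * b)) h
    beta_reduce at h'
    convert h' using 1 <;> abel
  have hc' : φ (star c) = star c := by rw [hφ.map_star, hc]
  have h1 := polar (star c) d hc' hd
  have h2 := polar (star c) (Complex.I • d) hc' (by rw [map_smul, hd])
  simp only [star_star, star_smul, smul_mul_assoc, mul_smul_comm, map_smul, Complex.star_def,
    Complex.conj_I, neg_smul, neg_mul, map_neg, ← sub_eq_add_neg, ← smul_sub] at h1 h2
  have h3 := smul_right_injective _ Complex.I_ne_zero h2
  have h4 := congrArg₂ (· + ·) h1 h3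
  simp only [add_add_sub_cancel, ← two_smul ℂ] at h4
  exact smul_right_injective _ two_ne_zero h4

end IsUCP

end ChoiEffros

section BoundarySubsystems

variable {H : Type*} [NormedAddCommGroup H] [InnerProductSpace ℂ H] [CompleteSpace H]
  {X V : Submodule ℂ (H →L[ℂ] H)} {φ : (H →L[ℂ] H) →ₗ[ℂ] (H →L[ℂ] H)}

theorem quotientCompletelyIsometricOn_iff : QuotientCompletelyIsometricOn X V ↔
    ∀ ν, ∀ x ∈ matrixSubspace X ν, ∀ y ∈ matrixSubspace V ν, ‖x‖ ≤ ‖x + y‖ := by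
  have hbdd : ∀ (ν : ℕ) (x : CStarMatrix (Fin ν) (Fin ν) (H →L[ℂ] H)),
      BddBelow (Set.range fun y : matrixSubspace V ν =>
        ‖x + (y : CStarMatrix (Fin ν) (Fin ν) (H →L[ℂ] H))‖) :=
    fun ν x => ⟨0, by rintro _ ⟨y, rfl⟩; exact norm_nonneg _⟩
  refine ⟨fun h ν x hx y hy => ?_, fun h ν x hx => le_antisymm ?_ ?_⟩
  · rw [← h ν x hx]
    exact ciInf_le (hbdd ν x) ⟨y, hy⟩
  · refine (ciInf_le (hbdd ν x) 0).trans ?_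
    simp
  · exact le_ciInf fun y => h ν x hx y y.2

theorem QuotientCompletelyIsometricOn.disjoint (h : QuotientCompletelyIsometricOn X V) :
    Disjoint X V := by
  rw [Submodule.disjoint_def]
  intro x hx hv
  let M : CStarMatrix (Fin 1) (Fin 1) (H →L[ℂ] H) := CStarMatrix.ofMatrix (Matrix.of fun _ _ => x)
  have h1 := quotientCompletelyIsometricOn_iff.1 h 1 M (fun _ _ => hx) (-M)
    (fun _ _ => V.neg_mem hv)
  rw [add_neg_cancel, norm_zero, norm_le_zero_iff] at h1
  exact congrFun (congrFun h1 0) 0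

theorem QuotientCompletelyIsometricOn.exists_isUCP (hX : 1 ∈ X)
    (h : QuotientCompletelyIsometricOn X V) :
    ∃ φ : (H →L[ℂ] H) →ₗ[ℂ] (H →L[ℂ] H), IsUCP φ ∧ (∀ x ∈ X, φ x = x) ∧ ∀ v ∈ V, φ v = 0 := by
  obtain ⟨g, hg⟩ := LinearMap.exists_leftInverse_of_injective (V.mkQ ∘ₗ X.subtype) (by
    rw [LinearMap.ker_eq_bot']
    intro x hx
    have hxV : (x : H →L[ℂ] H) ∈ V := by simpa using hx
    exact Subtype.ext (Submodule.disjoint_def.1 h.disjoint x x.2 hxV))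
  set f : (H →L[ℂ] H) →ₗ[ℂ] (H →L[ℂ] H) := X.subtype ∘ₗ g ∘ₗ V.mkQ
  have hfX : ∀ x ∈ X, f x = x := fun x hx =>
    congrArg Subtype.val (LinearMap.congr_fun hg ⟨x, hx⟩)
  have hfV : ∀ v ∈ V, f v = 0 := fun v hv => by
    simp [f, (Submodule.Quotient.mk_eq_zero V).2 hv]
  obtain ⟨φ, hφ, hφf⟩ := exists_isUCP_extension (Y := X ⊔ V) (Submodule.mem_sup_left hX)
    (hfX 1 hX) (by
      intro ν M hM
      choose x hx v hv hxv using fun i j => Submodule.mem_sup.1 (hM i j)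
      have h1 := quotientCompletelyIsometricOn_iff.1 h ν
        (CStarMatrix.ofMatrix (Matrix.of x)) hx (CStarMatrix.ofMatrix (Matrix.of v)) hv
      have h2 : M = CStarMatrix.ofMatrix (Matrix.of x) + CStarMatrix.ofMatrix (Matrix.of v) :=
        CStarMatrix.ext fun i j => (hxv i j).symm
      have h3 : M.map f = CStarMatrix.ofMatrix (Matrix.of x) := CStarMatrix.ext fun i j => by
        rw [CStarMatrix.map_apply, ← hxv, map_add, hfX _ (hx i j), hfV _ (hv i j), add_zero]
        rfl
      rwa [h3, h2])
  exact ⟨φ, hφ, fun x hx => (hφf x (Submodule.mem_sup_left hx)).trans (hfX x hx),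
    fun v hv => (hφf v (Submodule.mem_sup_right hv)).trans (hfV v hv)⟩

theorem IsUCP.isBoundarySubsystem_range_id_sub (hφ : IsUCP φ) (hφX : ∀ x ∈ X, φ x = x) :
    IsBoundarySubsystem X (LinearMap.range (LinearMap.id - φ)) where
  star_mem := by
    rintro _ ⟨a, rfl⟩
    exact ⟨star a, by simp [hφ.map_star]⟩
  completelyIsometric := by
    rw [quotientCompletelyIsometricOn_iff]
    intro ν x hx y hy
    choose a ha using hy
    set A : CStarMatrix (Fin ν) (Fin ν) (H →L[ℂ] H) := CStarMatrix.ofMatrix (Matrix.of a)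
    have hy' : y = A - A.map φ := CStarMatrix.ext fun i j => (ha i j).symm
    have hx' : x.map φ = x := CStarMatrix.ext fun i j => hφX _ (hx i j)
    have hmap : ∀ M N : CStarMatrix (Fin ν) (Fin ν) (H →L[ℂ] H),
        (M + N).map φ = M.map φ + N.map φ := fun M N =>
      CStarMatrix.ext fun i j => map_add φ _ _
    have hmap' : ∀ M N : CStarMatrix (Fin ν) (Fin ν) (H →L[ℂ] H),
        (M - N).map φ = M.map φ - N.map φ := fun M N =>
      CStarMatrix.ext fun i j => map_sub φ _ _
    let B : ℕ → CStarMatrix (Fin ν) (Fin ν) (H →L[ℂ] H) := fun n => (fun M => M.map φ)^[n] A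
    have hB : ∀ n, B (n + 1) = (B n).map φ := fun n => Function.iterate_succ_apply' _ _ _
    have hBA : ∀ n, ‖B n‖ ≤ ‖A‖ := by
      intro n
      induction n with
      | zero => exact le_rfl
      | succ n ih =>
        rw [hB]
        exact (hφ.norm_map_le _).trans ih
    have h1 : ∀ n, ‖x + (B n - B (n + 1))‖ ≤ ‖x + y‖ := by
      intro n
      induction n with
      | zero => rw [hy', hB]; exact le_rfl
      | succ n ih =>
        have : x + (B (n + 1) - B (n + 1 + 1)) = (x + (B n - B (n + 1))).map φ := by
          rw [hmap, hmap', hx', ← hB, ← hB]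
        rw [this]
        exact (hφ.norm_map_le _).trans ih
    have h2 : ∀ n : ℕ, ‖(n : ℂ) • x + (B 0 - B n)‖ ≤ n * ‖x + y‖ := by
      intro n
      induction n with
      | zero => simp
      | succ n ih =>
        have : ((n + 1 : ℕ) : ℂ) • x + (B 0 - B (n + 1)) =
            ((n : ℂ) • x + (B 0 - B n)) + (x + (B n - B (n + 1))) := by
          rw [Nat.cast_succ, add_smul, one_smul]
          abel
        rw [this, Nat.cast_succ, add_mul, one_mul]
        exact (norm_add_le _ _).trans (add_le_add ih (h1 n))
    have h3 : ∀ n : ℕ, n * (‖x‖ - ‖x + y‖) ≤ 2 * ‖A‖ := by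
      intro n
      have h4 : ‖(n : ℂ) • x‖ ≤ ‖(n : ℂ) • x + (B 0 - B n)‖ + ‖B 0 - B n‖ := by
        simpa using norm_sub_le ((n : ℂ) • x + (B 0 - B n)) (B 0 - B n)
      have h5 := norm_sub_le (B 0) (B n)
      rw [norm_smul, Complex.norm_natCast] at h4
      linarith [h2 n, hBA 0, hBA n]
    by_contra! hlt
    obtain ⟨n, hn⟩ := exists_nat_gt (2 * ‖A‖ / (‖x‖ - ‖x + y‖))
    rw [div_lt_iff₀ (sub_pos.2 hlt)] at hn
    exact (h3 n).not_gt hn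

theorem IsUCP.sub_mem_of_maximal (hV : Maximal (IsBoundarySubsystem X) V) (hφ : IsUCP φ)
    (hφX : ∀ x ∈ X, φ x = x) (hφV : ∀ v ∈ V, φ v = 0) (a : H →L[ℂ] H) : a - φ a ∈ V :=
  hV.le_of_ge (hφ.isBoundarySubsystem_range_id_sub hφX)
    (fun v hv => ⟨v, by simp [hφV v hv]⟩) ⟨a, rfl⟩

theorem IsUCP.map_map_of_maximal (hV : Maximal (IsBoundarySubsystem X) V) (hφ : IsUCP φ)
    (hφX : ∀ x ∈ X, φ x = x) (hφV : ∀ v ∈ V, φ v = 0) (a : H →L[ℂ] H) : φ (φ a) = φ a := by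
  have := hφV _ (hφ.sub_mem_of_maximal hV hφX hφV a)
  rw [map_sub, sub_eq_zero] at this
  exact this.symm

theorem IsUCP.mem_iff_of_maximal (hV : Maximal (IsBoundarySubsystem X) V) (hφ : IsUCP φ)
    (hφX : ∀ x ∈ X, φ x = x) (hφV : ∀ v ∈ V, φ v = 0) (a : H →L[ℂ] H) : a ∈ V ↔ φ a = 0 := by
  refine ⟨hφV a, fun ha => ?_⟩
  simpa [ha] using hφ.sub_mem_of_maximal hV hφX hφV a

theorem mul_mem_of_mem_generatedCStarAlgebra {W : Submodule ℂ (H →L[ℂ] H)}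
    (hW : IsClosed (W : Set (H →L[ℂ] H))) (h : ∀ x ∈ X, ∀ b ∈ W, x * b ∈ W ∧ star x * b ∈ W)
    {a : H →L[ℂ] H} (ha : a ∈ generatedCStarAlgebra X) {b : H →L[ℂ] H} (hb : b ∈ W) :
    a * b ∈ W := by
  have h1 : ∀ a ∈ StarAlgebra.adjoin ℂ (X : Set (H →L[ℂ] H)),
      ∀ b ∈ W, a * b ∈ W ∧ star a * b ∈ W := by
    intro a ha
    induction ha using StarAlgebra.adjoin_induction with
    | mem x hx => exact h x hx
    | algebraMap r =>
      intro b hb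
      rw [← algebraMap_star_comm, ← Algebra.smul_def, ← Algebra.smul_def]
      exact ⟨W.smul_mem _ hb, W.smul_mem _ hb⟩
    | add x y _ _ hx hy =>
      intro b hb
      rw [star_add, add_mul, add_mul]
      exact ⟨W.add_mem (hx b hb).1 (hy b hb).1, W.add_mem (hx b hb).2 (hy b hb).2⟩
    | mul x y _ _ hx hy =>
      intro b hb
      rw [star_mul, mul_assoc, mul_assoc]
      exact ⟨(hx _ (hy b hb).1).1, (hy _ (hx b hb).2).2⟩
    | star x _ hx =>
      intro b hb
      rw [star_star]
      exact (hx b hb).symm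
  have h2 : a ∈ closure (StarAlgebra.adjoin ℂ (X : Set (H →L[ℂ] H)) : Set (H →L[ℂ] H)) := ha
  have h3 : IsClosed {a : H →L[ℂ] H | a * b ∈ W} := hW.preimage (by fun_prop)
  exact closure_minimal (fun a ha => (h1 a ha b hb).1) h3 h2

end BoundarySubsystems

section SilovIdeal

variable {H : Type*} [NormedAddCommGroup H] [InnerProductSpace ℂ H] [CompleteSpace H]
  {X : Submodule ℂ (H →L[ℂ] H)} {φ ρ : (H →L[ℂ] H) →ₗ[ℂ] (H →L[ℂ] H)}

theorem IsUCP.map_mul_eq_zero_of_mem_generatedCStarAlgebra (hφ : IsUCP φ)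
    (hidem : ∀ a, φ (φ a) = φ a) (hφX : ∀ x ∈ X, φ x = x) {a b : H →L[ℂ] H}
    (ha : a ∈ generatedCStarAlgebra X) (hb : φ b = 0) : φ (a * b) = 0 := by
  refine mul_mem_of_mem_generatedCStarAlgebra (W := LinearMap.ker φ)
    (isClosed_singleton.preimage hφ.continuous) (fun x hx b hb => ⟨?_, ?_⟩) ha hb
  · exact hφ.map_mul_eq_zero hidem (hφX x hx) hb
  · exact hφ.map_star_mul_eq_zero hidem (hφX x hx) hb

theorem IsUCP.eq_of_mem_generatedCStarAlgebra (hφ : IsUCP φ) (hρ : IsUCP ρ)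
    (hφρ : ∀ a, φ (ρ a) = ρ a) (hρφ : ∀ a, ρ (φ a) = φ a) (hφX : ∀ x ∈ X, φ x = x)
    {a : H →L[ℂ] H} (ha : a ∈ generatedCStarAlgebra X) : φ a = ρ a := by
  have hφi : ∀ a, φ (φ a) = φ a := fun a => by rw [← hρφ a, hφρ]
  have hρi : ∀ a, ρ (ρ a) = ρ a := fun a => by rw [← hφρ a, hρφ]
  have key : ∀ c b, φ c = c → φ b = ρ b → φ (c * b) = ρ (c * b) := by
    intro c b hc hb
    have hc' : ρ c = c := by rw [← hc, hρφ]
    rw [← hφ.map_mul_map hφi hc, ← hρ.map_mul_map hρi hc', ← hb]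
    exact hφ.map_mul_eq_map_mul hρ hφρ hρφ hc (hφi b)
  have h := mul_mem_of_mem_generatedCStarAlgebra (X := X) (W := LinearMap.ker (φ - ρ))
    (isClosed_singleton.preimage (hφ.continuous.sub hρ.continuous))
    (fun x hx b hb => by
      rw [LinearMap.mem_ker, LinearMap.sub_apply, sub_eq_zero] at hb
      simp only [LinearMap.mem_ker, LinearMap.sub_apply, sub_eq_zero]
      exact ⟨key x b (hφX x hx) hb, key (star x) b (by rw [hφ.map_star, hφX x hx]) hb⟩)
    ha (b := 1) (by simp [hφ.map_one, hρ.map_one])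
  rwa [mul_one, LinearMap.mem_ker, LinearMap.sub_apply, sub_eq_zero] at h

theorem mem_idealSubspace {I : Ideal (generatedCStarAlgebra X)} {a : H →L[ℂ] H} :
    a ∈ idealSubspace X I ↔ ∃ h : a ∈ generatedCStarAlgebra X, ⟨a, h⟩ ∈ I := by
  constructor
  · rintro ⟨b, hb, rfl⟩
    exact ⟨b.2, hb⟩
  · rintro ⟨h, ha⟩
    exact ⟨⟨a, h⟩, ha, rfl⟩

/-- The kernel in `C*(X)` of a completely positive projection which fixes `X`. -/
def IsUCP.kerIdeal (hφ : IsUCP φ) (hidem : ∀ a, φ (φ a) = φ a) (hφX : ∀ x ∈ X, φ x = x) :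
    Ideal (generatedCStarAlgebra X) where
  carrier := {a | φ a = 0}
  add_mem' {a b} ha hb := by
    change φ ((a : H →L[ℂ] H) + b) = 0
    rw [map_add, ha, hb, add_zero]
  zero_mem' := map_zero φ
  smul_mem' a _ hb := hφ.map_mul_eq_zero_of_mem_generatedCStarAlgebra hidem hφX a.2 hb

end SilovIdeal

theorem mainTheorem3 {H : Type*} [NormedAddCommGroup H] [InnerProductSpace ℂ H] [CompleteSpace H]
    (X : Submodule ℂ (H →L[ℂ] H)) (hX : (1 : H →L[ℂ] H) ∈ X)
    (V : Submodule ℂ (H →L[ℂ] H)) (hV : Maximal (IsBoundarySubsystem X) V) :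
    ∃ I : Ideal (generatedCStarAlgebra X), IsSilovIdeal X I ∧
      (idealSubspace X I : Set (H →L[ℂ] H)) =
        (V : Set (H →L[ℂ] H)) ∩ (generatedCStarAlgebra X : Set (H →L[ℂ] H)) := by
  obtain ⟨φ, hφ, hφX, hφV⟩ := hV.prop.completelyIsometric.exists_isUCP hX
  have hidem := hφ.map_map_of_maximal hV hφX hφV
  have hmem := hφ.mem_iff_of_maximal hV hφX hφV
  have hI : ∀ a : generatedCStarAlgebra X, a ∈ hφ.kerIdeal hidem hφX ↔ φ a = 0 := fun a => Iff.rfl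
  have hle : idealSubspace X (hφ.kerIdeal hidem hφX) ≤ V := fun a ha => by
    obtain ⟨_, h⟩ := mem_idealSubspace.1 ha
    exact (hmem a).2 h
  refine ⟨hφ.kerIdeal hidem hφX, ⟨⟨⟨fun {a} b ha => ?_⟩, ?_, ?_⟩, fun J hJ j hj => ?_⟩, ?_⟩
  · rw [hI] at ha ⊢
    have h1 : φ (star (b : H →L[ℂ] H) * star (a : H →L[ℂ] H)) = 0 :=
      hφ.map_mul_eq_zero_of_mem_generatedCStarAlgebra hidem hφX (star_mem b.2)
        (by rw [hφ.map_star, ha, star_zero])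
    rw [← star_mul, hφ.map_star, star_eq_zero] at h1
    exact h1
  · exact isClosed_singleton.preimage (hφ.continuous.comp continuous_subtype_val)
  · have h := quotientCompletelyIsometricOn_iff.1 hV.prop.completelyIsometric
    exact quotientCompletelyIsometricOn_iff.2 fun ν x hx y hy =>
      h ν x hx y fun i j => hle (hy i j)
  · obtain ⟨θ, hθ, hθX, hθJ⟩ := hJ.completelyIsometric.exists_isUCP hX
    have hσ := hφ.comp (hθ.comp hφ)
    have hσX : ∀ x ∈ X, (φ ∘ₗ θ ∘ₗ φ) x = x := fun x hx => by
      simp [hφX x hx, hθX x hx]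
    have hσV : ∀ v ∈ V, (φ ∘ₗ θ ∘ₗ φ) v = 0 := fun v hv => by simp [hφV v hv]
    have hρφ : ∀ a, φ (θ (φ a)) = φ a := by
      intro a
      have h1 := hφV _ (hσ.sub_mem_of_maximal hV hσX hσV a)
      rw [map_sub, sub_eq_zero, LinearMap.comp_apply, hidem] at h1
      exact h1.symm
    have hj' := hφ.eq_of_mem_generatedCStarAlgebra (hφ.comp hθ) (fun a => hidem _) hρφ hφX j.2
    rw [hI, hj', LinearMap.comp_apply, hθJ j (mem_idealSubspace.2 ⟨j.2, hj⟩), map_zero]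
  · ext a
    simp only [SetLike.mem_coe, Set.mem_inter_iff, mem_idealSubspace, hI, hmem]
    exact ⟨fun ⟨h, ha⟩ => ⟨ha, h⟩, fun ⟨ha, h⟩ => ⟨h, ha⟩⟩
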